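/- Let $G$ be a simply connected real Lie group whose Lie algebra $\mathfrak g$ is of type $\mathfrak g_{3,1}$ (the Heisenberg algebra; for example, $G$ is the Heisenberg group $H_3$): $\mathfrak g$ has an ordered basis $(E_1,E_2,E_3)$ with $[E_1,E_2]=0$, $[E_3,E_1]=0$, $[E_2,E_3]=E_1$. Fix such a basis. (1) A linear map $\mathcal D:\mathfrak g\to\mathfrak g$ is a derivation of $\mathfrak g$ if and only if its matrix in the basis $(E_1,E_2,E_3)$ (the $j$-th column being the coordinates of $\mathcal D(E_j)$) has the form $$\mathcal D=\begin{pmatrix} y_2+z_3 & x_2 & x_3\\ 0 & y_2 & y_3\\ 0 & z_2 & z_3\end{pmatrix},\qquad x_2,x_3,y_2,y_3,z_2,z_3\in\mathbb R.$$ (2) Let $\varphi_t$ be a linear flow on $G$, that is, the flow of a smooth vector field $\mathcal X$ on $G$ such that every $\varphi_t$ $(t\in\mathbb R)$ is an automorphism of the Lie group $G$. Then $\mathcal D(Y)=-[\mathcal X,Y]$, for $Y$ a left invariant vector field, defines a derivation of $\mathfrak g$, and if the entries of its matrix, written as in (1), satisfy $$y_2+z_3=0\quad\text{and}\quad (y_2-z_3)^2+4\,y_3z_2<0,$$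 then $\varphi_t$ has a periodic orbit: there are $g\in G$, not a fixed point of the flow, and $T>0$ such that $\varphi_{t+T}(g)=\varphi_t(g)$ for all $t\in\mathbb R$. -/

import Mathlib

open scoped Manifold ContDiff

/-- A smooth real Lie group has enough regularity for Mathlib's Lie algebra structure on its
tangent space at the identity. -/
instance instLieGroupMinSmoothness {n : ℕ} {G : Type*} [TopologicalSpace G]
    [ChartedSpace (EuclideanSpace ℝ (Fin n)) G] [Group G] [LieGroup (𝓡 n) ∞ G] :
    LieGroup (𝓡 n) (minSmoothness ℝ 3) G := by
  rw [minSmoothness_of_isRCLikeNormedField]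
  exact inferInstance

/-- An ordered basis `(E₁, E₂, E₃)` (indexed by `0, 1, 2`) of a real Lie algebra exhibits it as
being of type `𝔤_{3,1}` (Heisenberg): `[E₁, E₂] = 0`, `[E₃, E₁] = 0`, `[E₂, E₃] = E₁`. -/
structure IsTypeG31Basis {L : Type*} [LieRing L] [LieAlgebra ℝ L]
    (E : Module.Basis (Fin 3) ℝ L) : Prop where
  lie_one_two : ⁅E 0, E 1⁆ = 0
  lie_three_one : ⁅E 2, E 0⁆ = 0
  lie_two_three : ⁅E 1, E 2⁆ = E 0

/-- The matrix
`( y₂+z₃  x₂  x₃ ;  0  y₂  y₃ ;  0  z₂  z₃ )`. -/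
def g31Block (x₂ x₃ y₂ y₃ z₂ z₃ : ℝ) : Matrix (Fin 3) (Fin 3) ℝ :=
  !![y₂ + z₃, x₂, x₃;
     0,       y₂, y₃;
     0,       z₂, z₃]

section LinearFlow

variable {n : ℕ} {G : Type*} [TopologicalSpace G]
  [ChartedSpace (EuclideanSpace ℝ (Fin n)) G] [Group G] [LieGroup (𝓡 n) ∞ G]

/-- `φ` is the (global) flow of the smooth vector field `𝒳` on `G`, and every `φ t` is an
automorphism of the Lie group `G`. In other words, `𝒳` is a linear vector field and `φ` is its
linear flow. -/
structure IsLinearFlow (𝒳 : (g : G) → TangentSpace (𝓡 n) g) (φ : ℝ → G → G) : Prop where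
  smooth : ContMDiff (𝓡 n) (𝓡 n).tangent ∞
    (fun g : G => (⟨g, 𝒳 g⟩ : TangentBundle (𝓡 n) G))
  map_zero : ∀ g, φ 0 g = g
  integralCurve : ∀ g, IsMIntegralCurve (I := 𝓡 n) (fun t => φ t g) 𝒳
  automorphism : ∀ t, ∃ e : G ≃* G, (∀ g, e g = φ t g) ∧
    ContMDiff (𝓡 n) (𝓡 n) ∞ e ∧ ContMDiff (𝓡 n) (𝓡 n) ∞ e.symm

/-- The derivation `D` of the Lie algebra of `G` is the one associated to the vector field `𝒳`:
`D(Y) = -[𝒳, Y]` for every left invariant vector field `Y` on `G`. -/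
def IsAssociatedDerivation (𝒳 : (g : G) → TangentSpace (𝓡 n) g)
    (D : LieDerivation ℝ (GroupLieAlgebra (𝓡 n) G) (GroupLieAlgebra (𝓡 n) G)) : Prop :=
  ∀ (v : GroupLieAlgebra (𝓡 n) G) (g : G),
    mulInvariantVectorField (D v) g =
      -VectorField.mlieBracket (𝓡 n) 𝒳 (mulInvariantVectorField v) g

end LinearFlow

/-- `φ` has a periodic orbit: the orbit of some point that is not a fixed point of the flow is
periodic with some period `T > 0`. -/
def HasPeriodicOrbit {X : Type*} (φ : ℝ → X → X) : Prop :=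
  ∃ g : X, (∃ t : ℝ, φ t g ≠ g) ∧ ∃ T : ℝ, 0 < T ∧ ∀ t : ℝ, φ (t + T) g = φ t g

/-! A linear flow fixes the identity, and in a chart there the coordinate formula for the bracket
shows that the derivation `D` is the linearization of `𝒳` at `1`. Trace zero and negative
discriminant give `D` the eigenvalues `0, ±iν`, so `D³ = -ν²D`, the group `exp(sD)` is an explicit
trigonometric expression, and `exp(TD) = 1` for `T = 2π/ν`. Hence the automorphism `φ T` has
identity derivative at `1` and, `G` being connected, is the identity. Every orbit therefore closes
up after time `T`, and `D ≠ 0` excludes that all points are fixed.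

Three arguments carry this. `hasFDerivAt_flow_period` computes the derivative of `φ T` at `1` by a
Gronwall estimate in a chart, without differentiating the flow in its initial condition elsewhere.
`eq_of_modelDeriv_one_eq_id` is the rigidity of endomorphisms.
`IsLinearFlow.mulInvariantVectorField_mlieBracket` shows that `[𝒳, Y]` is left invariant, because
left translation changes `𝒳` by a right invariant field, which commutes with `Y`. -/

section HeisenbergAlgebra

/-! ### Derivations of the Heisenberg algebra -/

variable {L : Type*} [LieRing L] [LieAlgebra ℝ L] {E : Module.Basis (Fin 3) ℝ L}

/-- The bracket of a Heisenberg algebra in coordinates. -/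
theorem IsTypeG31Basis.lie_eq (hE : IsTypeG31Basis E) (a b : L) :
    ⁅a, b⁆ = (E.repr a 1 * E.repr b 2 - E.repr a 2 * E.repr b 1) • E 0 := by
  have h10 : ⁅E 1, E 0⁆ = 0 := by rw [← lie_skew, hE.lie_one_two, neg_zero]
  have h02 : ⁅E 0, E 2⁆ = 0 := by rw [← lie_skew, hE.lie_three_one, neg_zero]
  have h21 : ⁅E 2, E 1⁆ = -E 0 := by rw [← lie_skew, hE.lie_two_three]
  conv_lhs => rw [← E.sum_repr a, ← E.sum_repr b]
  simp only [Fin.sum_univ_three, add_lie, lie_add, smul_lie, lie_smul, lie_self, h10, h02, h21,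
    hE.lie_one_two, hE.lie_three_one, hE.lie_two_three]
  module

theorem repr_apply_eq_sum_toMatrix (D : L →ₗ[ℝ] L) (a : L) (i : Fin 3) :
    E.repr (D a) i = ∑ j, LinearMap.toMatrix E E D i j * E.repr a j := by
  rw [← LinearMap.toMatrix_mulVec_repr E E D a]
  rfl

/-- The bracket is the area form of the last two coordinates times `E 0`. The Leibniz rule on `[E 1,
E 2] = E 0` forces `E 0` to be scaled by the trace of the planar block. Conversely, a planar map
acts infinitesimally on the area form by its trace, which is the Leibniz rule. -/
theorem IsTypeG31Basis.exists_lieDerivation_iff (hE : IsTypeG31Basis E) (D : L →ₗ[ℝ] L) :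
    (∃ δ : LieDerivation ℝ L L, δ.toLinearMap = D) ↔
      ∃ x₂ x₃ y₂ y₃ z₂ z₃ : ℝ, LinearMap.toMatrix E E D = g31Block x₂ x₃ y₂ y₃ z₂ z₃ := by
  constructor
  · rintro ⟨δ, rfl⟩
    have h0 : δ (E 0) = (E.repr (δ (E 1)) 1 + E.repr (δ (E 2)) 2) • E 0 := by
      conv_lhs => rw [← hE.lie_two_three, δ.apply_lie_eq_sub, hE.lie_eq, hE.lie_eq]
      simp [add_smul, add_comm]
    refine ⟨E.repr (δ (E 1)) 0, E.repr (δ (E 2)) 0, E.repr (δ (E 1)) 1, E.repr (δ (E 2)) 1,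
      E.repr (δ (E 1)) 2, E.repr (δ (E 2)) 2, ?_⟩
    ext i j
    rw [LinearMap.toMatrix_apply]
    fin_cases j
    · fin_cases i <;> simp [g31Block, h0]
    · fin_cases i <;> simp [g31Block]
    · fin_cases i <;> simp [g31Block]
  · rintro ⟨x₂, x₃, y₂, y₃, z₂, z₃, hM⟩
    refine ⟨⟨D, fun a b => ?_⟩, rfl⟩
    have h0 : D (E 0) = (y₂ + z₃) • E 0 := by
      apply E.repr.injective
      ext i
      rw [repr_apply_eq_sum_toMatrix, hM]
      fin_cases i <;> simp [g31Block, Fin.sum_univ_three]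
    have hr := repr_apply_eq_sum_toMatrix (E := E) D
    rw [hE.lie_eq a b, hE.lie_eq a, hE.lie_eq b, map_smul, h0]
    simp only [hr, hM]
    simp only [g31Block, Fin.sum_univ_three]
    simp
    module

/-- A traceless derivation whose planar block has negative discriminant has eigenvalues
`0, ± i ν`. -/
theorem exists_frequency_of_toMatrix_eq {D : L →ₗ[ℝ] L} {x₂ x₃ y₂ y₃ z₂ z₃ : ℝ}
    (hM : LinearMap.toMatrix E E D = g31Block x₂ x₃ y₂ y₃ z₂ z₃) (htr : y₂ + z₃ = 0)
    (hdisc : (y₂ - z₃) ^ 2 + 4 * y₃ * z₂ < 0) :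
    D ≠ 0 ∧ ∃ ν : ℝ, 0 < ν ∧ ∀ v, D (D (D v)) = -(ν ^ 2) • D v := by
  obtain rfl : z₃ = -y₂ := by linarith
  constructor
  · rintro rfl
    rw [map_zero] at hM
    have h1 := congrFun (congrFun hM 1) 2
    have h2 := congrFun (congrFun hM 1) 1
    simp [g31Block] at h1 h2
    subst h1 h2
    simp at hdisc
  -- The discriminant is now `4(y₂² + y₃z₂)`, so `ν²` is the determinant of the traceless planar
  -- block `B`. Cayley–Hamilton gives `B² = -ν²`, and since the first column of `D` vanishes, `D³ =
  -- -ν²D`.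
  · have hpos : 0 < -(y₂ ^ 2 + y₃ * z₂) := by nlinarith
    refine ⟨√(-(y₂ ^ 2 + y₃ * z₂)), Real.sqrt_pos.2 hpos, fun v => ?_⟩
    rw [Real.sq_sqrt hpos.le]
    have hr := repr_apply_eq_sum_toMatrix (E := E) D
    apply E.repr.injective
    ext i
    rw [map_smul, Finsupp.smul_apply]
    simp only [hr, hM]
    fin_cases i <;> simp [g31Block, Fin.sum_univ_three] <;> ring

end HeisenbergAlgebra

/-! ### Linearizing the period map at a singularity -/

section RotationFlow

open Set Filter Topology

/-- A continuous curve that cannot come close to the boundary of a chart ball before leaving it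
stays in this ball. -/
theorem forall_mem_chart_ball_of_bootstrap {F : Type*} [NormedAddCommGroup F]
    {M : Type*} [TopologicalSpace M] [T2Space M]
    [ProperSpace F] (e : OpenPartialHomeomorph M F) {γ : ℝ → M} (hγ : Continuous γ) {o : F}
    {r ρ T : ℝ} (hρ : ρ < r) (hr : Metric.ball o r ⊆ e.target) (h0 : γ 0 ∈ e.source)
    (h0' : e (γ 0) ∈ Metric.ball o r)
    (hstep : ∀ τ, τ ≤ T → (∀ s ∈ Ico 0 τ, γ s ∈ e.source ∧ e (γ s) ∈ Metric.ball o r) →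
      ∀ s ∈ Ico 0 τ, e (γ s) ∈ Metric.closedBall o ρ) :
    ∀ s ∈ Icc 0 T, γ s ∈ e.source ∧ e (γ s) ∈ Metric.ball o r := by
  by_contra! hcon
  set V : Set M := e.source ∩ e ⁻¹' Metric.ball o r
  have hV : IsOpen V := e.isOpen_inter_preimage Metric.isOpen_ball
  have hB : IsCompact (Icc 0 T ∩ γ ⁻¹' Vᶜ) :=
    isCompact_Icc.inter_right (hV.isClosed_compl.preimage hγ)
  have hBne : (Icc 0 T ∩ γ ⁻¹' Vᶜ).Nonempty := by
    obtain ⟨s, hs, h⟩ := hcon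
    exact ⟨s, hs, fun hs' => h hs'.1 hs'.2⟩
  -- `τ` is the first exit time. Before `τ` the curve lies in the compact image of the smaller
  -- closed ball; that image is closed, `M` being Hausdorff, so it contains `γ τ`, a contradiction.
  obtain ⟨τ, ⟨hτ, hτV⟩, hleast⟩ := hB.exists_isLeast hBne
  have hτ0 : 0 < τ := lt_of_le_of_ne hτ.1 (by rintro rfl; exact hτV ⟨h0, h0'⟩)
  have hin : ∀ s ∈ Ico 0 τ, γ s ∈ V := fun s hs => by
    by_contra hsV
    exact absurd (hleast ⟨⟨hs.1, hs.2.le.trans hτ.2⟩, hsV⟩) (not_le.2 hs.2)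
  have hsub : Metric.closedBall o ρ ⊆ e.target :=
    (Metric.closedBall_subset_ball hρ).trans hr
  have hKc : IsClosed (e.symm '' Metric.closedBall o ρ) :=
    ((isCompact_closedBall o ρ).image_of_continuousOn (e.continuousOn_symm.mono hsub)).isClosed
  have hmem : γ τ ∈ e.symm '' Metric.closedBall o ρ := by
    have hcl : τ ∈ closure (Ico 0 τ) := by
      rw [closure_Ico hτ0.ne]
      exact right_mem_Icc.2 hτ0.le
    refine hKc.closure_subset_iff.2 ?_ (hγ.continuousAt.continuousWithinAt.mem_closure_image hcl)
    rintro _ ⟨s, hs, rfl⟩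
    exact ⟨e (γ s), hstep τ hτ.2 hin s hs, e.left_inv (hin s hs).1⟩
  obtain ⟨y, hy, hyτ⟩ := hmem
  apply hτV
  rw [← hyτ]
  refine ⟨e.map_target (hsub hy), ?_⟩
  change e (e.symm y) ∈ Metric.ball o r
  rw [e.right_inv (hsub hy)]
  exact Metric.closedBall_subset_ball hρ hy

variable {F : Type*} [NormedAddCommGroup F] [NormedSpace ℝ F]

/-- The one-parameter group generated by an endomorphism `A` with `A ^ 3 = -ν ^ 2 A`. -/
noncomputable def rotationGroup (A : F →L[ℝ] F) (ν s : ℝ) : F →L[ℝ] F :=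
  1 + (Real.sin (ν * s) / ν) • A + ((1 - Real.cos (ν * s)) / ν ^ 2) • A ^ 2

theorem rotationGroup_zero (A : F →L[ℝ] F) (ν : ℝ) : rotationGroup A ν 0 = 1 := by
  simp [rotationGroup]

theorem rotationGroup_neg_period (A : F →L[ℝ] F) {ν : ℝ} (hν : 0 < ν) :
    rotationGroup A ν (-(2 * Real.pi / ν)) = 1 := by
  have : ν * (2 * Real.pi / ν) = 2 * Real.pi := by field_simp
  simp [rotationGroup, this]

/-- Since `A⁴ = -ν²A²`, the product reduces to `sin² + cos² = 1`. Of the group law only this inverse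
relation is needed. -/
theorem rotationGroup_mul_neg {A : F →L[ℝ] F} {ν : ℝ} (hν : 0 < ν)
    (hA : A ^ 3 = -(ν ^ 2) • A) (s : ℝ) :
    rotationGroup A ν s * rotationGroup A ν (-s) = 1 := by
  have hA4 : A ^ 4 = -(ν ^ 2) • A ^ 2 := by
    rw [pow_succ, hA, smul_mul_assoc, ← pow_two]
  have hsc := Real.sin_sq_add_cos_sq (ν * s)
  simp only [rotationGroup, mul_neg, Real.sin_neg, Real.cos_neg]
  set p := Real.sin (ν * s)
  set q := Real.cos (ν * s)
  have h22 : A ^ 2 * A ^ 2 = -(ν ^ 2) • A ^ 2 := by rw [← pow_add, hA4]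
  have h12 : A * A ^ 2 = -(ν ^ 2) • A := by rw [← hA, pow_succ' A 2]
  have h21 : A ^ 2 * A = -(ν ^ 2) • A := by rw [← hA, pow_succ A 2]
  simp only [add_mul, mul_add, one_mul, mul_one, smul_mul_assoc, mul_smul_comm, h22, h12, h21,
    ← pow_two A]
  match_scalars
  · ring
  · ring
  · field_simp
    linear_combination -hsc

theorem norm_rotationGroup_le (A : F →L[ℝ] F) {ν : ℝ} (hν : 0 < ν) (s : ℝ) :
    ‖rotationGroup A ν s‖ ≤ 1 + 1 / ν * ‖A‖ + 2 / ν ^ 2 * ‖A ^ 2‖ := by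
  refine (norm_add_le _ _).trans (add_le_add ((norm_add_le _ _).trans (add_le_add ?_ ?_)) ?_)
  · exact ContinuousLinearMap.norm_id_le
  · rw [norm_smul, Real.norm_eq_abs, abs_div, abs_of_pos hν]
    gcongr
    exact Real.abs_sin_le_one _
  · rw [norm_smul, Real.norm_eq_abs, abs_div, abs_of_pos (pow_pos hν 2)]
    gcongr
    rw [abs_le]
    constructor <;> linarith [Real.cos_le_one (ν * s), Real.neg_one_le_cos (ν * s)]

theorem hasDerivAt_rotationGroup_neg {A : F →L[ℝ] F} {ν : ℝ} (hν : 0 < ν)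
    (hA : A ^ 3 = -(ν ^ 2) • A) (s : ℝ) :
    HasDerivAt (fun s => rotationGroup A ν (-s)) (-(rotationGroup A ν (-s) * A)) s := by
  have hlin : HasDerivAt (fun s : ℝ => ν * -s) (-ν) s := by
    simpa using ((hasDerivAt_id s).neg.const_mul ν)
  have h1 := (hlin.sin.div_const ν).smul_const A
  have h2 := ((hlin.cos.const_sub 1).div_const (ν ^ 2)).smul_const (A ^ 2)
  refine ((h1.const_add 1).add h2).congr_deriv ?_
  simp only [rotationGroup, add_mul, one_mul, smul_mul_assoc, ← pow_two, ← pow_succ, hA]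
  match_scalars
  · field_simp
    ring
  · field_simp

/-- Variation of constants: `z = exp(-sA) x` satisfies `z' = exp(-sA)(x' - A x)`, of norm at most
`Cε‖x‖ ≤ C²ε‖z‖`. One factor `C` comes from `exp(-sA)`, the other from recovering `x = exp(sA) z`.
Gronwall is applied to `z - x 0`, which starts at zero. -/
theorem norm_rotationGroup_neg_apply_sub_le {A : F →L[ℝ] F} {ν C ε τ : ℝ} (hν : 0 < ν)
    (hA : A ^ 3 = -(ν ^ 2) • A) (hC : ∀ s, ‖rotationGroup A ν s‖ ≤ C) (hε : 0 < ε)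
    {x x' : ℝ → F} (hx : ∀ s ∈ Icc 0 τ, HasDerivAt x (x' s) s)
    (hb : ∀ s ∈ Icc 0 τ, ‖x' s - A (x s)‖ ≤ ε * ‖x s‖) (hC1 : 1 ≤ C) :
    ∀ s ∈ Icc 0 τ, ‖rotationGroup A ν (-s) (x s) - x 0‖ ≤
      (Real.exp (C ^ 2 * ε * s) - 1) * ‖x 0‖ := by
  have hd : ∀ s ∈ Icc 0 τ, HasDerivAt (fun s => rotationGroup A ν (-s) (x s) - x 0)
      (rotationGroup A ν (-s) (x' s - A (x s))) s := fun s hs => by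
    refine (((hasDerivAt_rotationGroup_neg hν hA s).clm_apply (hx s hs)).sub_const _).congr_deriv ?_
    simp [sub_eq_add_neg, add_comm]
  have hK : C ^ 2 * ε ≠ 0 := by positivity
  intro s hs
  have key := norm_le_gronwallBound_of_norm_deriv_right_le (δ := 0) (K := C ^ 2 * ε)
    (ε := C ^ 2 * ε * ‖x 0‖) (a := 0) (b := τ)
    (fun s hs => (hd s hs).continuousAt.continuousWithinAt)
    (fun s hs => (hd s (Ico_subset_Icc_self hs)).hasDerivWithinAt)
    (by simp [rotationGroup_zero]) (fun s hs => ?_) s hs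
  · rw [gronwallBound_of_K_ne_0 hK] at key
    refine key.trans (le_of_eq ?_)
    simp only [sub_zero, zero_mul, zero_add, mul_div_cancel_left₀ _ hK]
    ring
  · have hs' := Ico_subset_Icc_self hs
    set z := rotationGroup A ν (-s) (x s)
    have hxz : x s = rotationGroup A ν s z := by
      change x s = (rotationGroup A ν s * rotationGroup A ν (-s)) (x s)
      rw [rotationGroup_mul_neg hν hA]
      rfl
    have h1 : ‖x s‖ ≤ C * ‖z‖ := by
      conv_lhs => rw [hxz]
      exact (rotationGroup A ν s).le_of_opNorm_le (hC s) z
    have h2 : ‖z‖ ≤ ‖z - x 0‖ + ‖x 0‖ := by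
      simpa using norm_add_le (z - x 0) (x 0)
    calc ‖rotationGroup A ν (-s) (x' s - A (x s))‖
        ≤ C * ‖x' s - A (x s)‖ := (rotationGroup A ν (-s)).le_of_opNorm_le (hC _) _
      _ ≤ C * (ε * (C * (‖z - x 0‖ + ‖x 0‖))) := by
        gcongr
        exact (hb s hs').trans (by gcongr; exact h1.trans (by gcongr))
      _ = _ := by ring

/-- If the linearization `A` of a vector field at a singularity satisfies `A ^ 3 = -ν ^ 2 A`, then
the linearization of the time `2π/ν` map of its flow is the identity. -/
theorem hasFDerivAt_flow_period {M : Type*} [TopologicalSpace M] [T2Space M]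
    [ProperSpace F] (e : OpenPartialHomeomorph M F) {o : F} (ho : o ∈ e.target)
    {A : F →L[ℝ] F} {ν : ℝ} (hν : 0 < ν) (hA : A ^ 3 = -(ν ^ 2) • A)
    {X : F → F} (hX : HasFDerivAt X A o) (hX0 : X o = 0) {φ : ℝ → M → M} (hφ0 : ∀ g, φ 0 g = g)
    (hφc : ∀ g, Continuous fun t => φ t g)
    (hφ : ∀ g t, φ t g ∈ e.source → HasDerivAt (fun s => e (φ s g)) (X (e (φ t g))) t) :
    HasFDerivAt (fun x => e (φ (2 * Real.pi / ν) (e.symm x))) (ContinuousLinearMap.id ℝ F) o := by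
  set T := 2 * Real.pi / ν
  have hT : 0 < T := by positivity
  obtain ⟨C, hC1, hC⟩ : ∃ C, 1 ≤ C ∧ ∀ s, ‖rotationGroup A ν s‖ ≤ C :=
    ⟨_, by rw [add_assoc, le_add_iff_nonneg_right]; positivity, norm_rotationGroup_le A hν⟩
  have hC0 : 0 < C := by linarith
  -- The period map is the identity up to `o(‖x - o‖)`. The restriction `c ≤ 1` serves to bound `z`
  -- by `2‖x - o‖` below.
  have key : ∀ c : ℝ, 0 < c → c ≤ 1 →
      ∀ᶠ x in 𝓝 o, ‖e (φ T (e.symm x)) - x‖ ≤ c * ‖x - o‖ := by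
    intro c hc hc1
    obtain ⟨ε, hε, hεc⟩ : ∃ ε : ℝ, 0 < ε ∧ Real.exp (C ^ 2 * ε * T) - 1 ≤ c := by
      -- Chosen so that `exp(C²εT) = 1 + c`.
      refine ⟨Real.log (1 + c) / (C ^ 2 * T), div_pos (Real.log_pos (by linarith)) (by positivity),
        ?_⟩
      have : C ^ 2 * (Real.log (1 + c) / (C ^ 2 * T)) * T = Real.log (1 + c) := by field_simp
      rw [this, Real.exp_log (by linarith)]
      linarith
    have hexp : ∀ s ∈ Icc 0 T, Real.exp (C ^ 2 * ε * s) - 1 ≤ c := fun s hs =>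
      le_trans (by gcongr; exact hs.2) hεc
    obtain ⟨r, hr, hball⟩ : ∃ r > 0, Metric.ball o r ⊆
        e.target ∩ {y | ‖X y - A (y - o)‖ ≤ ε * ‖y - o‖} := by
      apply Metric.mem_nhds_iff.1
      refine inter_mem (e.open_target.mem_nhds ho) ?_
      filter_upwards [hX.isLittleO.def hε] with y hy
      simpa [hX0] using hy
    -- With `‖z‖ ≤ 2‖x - o‖` and `‖exp(sA)‖ ≤ C`, this radius keeps the orbit within `r / 2` of `o`
    -- up to time `T`.
    have hnear : ∀ᶠ x in 𝓝 o, ‖x - o‖ < r / (4 * C) := by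
      filter_upwards [Metric.ball_mem_nhds o (show 0 < r / (4 * C) by positivity)] with x hx
      rwa [← mem_ball_iff_norm]
    filter_upwards [hnear, e.open_target.mem_nhds ho] with x hx hxt
    set g := e.symm x
    have hgs : g ∈ e.source := e.map_target hxt
    have hx0 : e (φ 0 g) = x := by rw [hφ0]; exact e.right_inv hxt
    have hest : ∀ τ ∈ Icc 0 T,
        (∀ s ∈ Icc 0 τ, φ s g ∈ e.source ∧ e (φ s g) ∈ Metric.ball o r) →
        ‖rotationGroup A ν (-τ) (e (φ τ g) - o) - (x - o)‖ ≤ c * ‖x - o‖ := by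
      intro τ hτ h
      have := norm_rotationGroup_neg_apply_sub_le (x := fun s => e (φ s g) - o) (τ := τ) hν hA hC hε
        (fun s hs => (hφ g s (h s hs).1).sub_const o) (fun s hs => (hball (h s hs).2).2) hC1 τ
        (right_mem_Icc.2 hτ.1)
      rw [hx0] at this
      exact this.trans (by gcongr; exact hexp τ hτ)
    have hstay := forall_mem_chart_ball_of_bootstrap e (hφc g) (T := T) (ρ := r / 2) (r := r)
      (o := o) (by linarith) (fun y hy => (hball hy).1) (by rwa [hφ0]) (by
        rw [hx0, mem_ball_iff_norm]
        refine hx.trans_le (div_le_self hr.le (by linarith))) (by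
        intro τ hτ h s hs
        have hs1 := hest s ⟨hs.1, hs.2.le.trans hτ⟩ fun u hu => h u ⟨hu.1, hu.2.trans_lt hs.2⟩
        set z := rotationGroup A ν (-s) (e (φ s g) - o)
        have hxz : e (φ s g) - o = rotationGroup A ν s z := by
          change _ = (rotationGroup A ν s * rotationGroup A ν (-s)) (e (φ s g) - o)
          rw [rotationGroup_mul_neg hν hA]
          rfl
        have hz : ‖z‖ ≤ 2 * ‖x - o‖ := by
          have := norm_add_le (z - (x - o)) (x - o)
          rw [sub_add_cancel] at this
          nlinarith [norm_nonneg (x - o)]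
        rw [mem_closedBall_iff_norm, hxz]
        calc ‖rotationGroup A ν s z‖ ≤ C * ‖z‖ := (rotationGroup A ν s).le_of_opNorm_le (hC s) z
          _ ≤ C * (2 * (r / (4 * C))) := by gcongr; exact hz.trans (by gcongr)
          _ = r / 2 := by field_simp; ring)
    have hfin := hest T (right_mem_Icc.2 hT.le) hstay
    -- At time `T` the linear flow is the identity, so the estimate concerns the period map itself.
    rw [rotationGroup_neg_period A hν] at hfin
    simpa using hfin
  have hfix : e (φ T (e.symm o)) = o := by
    have := (key 1 one_pos le_rfl).self_of_nhds
    simpa [sub_eq_zero] using this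
  rw [hasFDerivAt_iff_isLittleO, Asymptotics.isLittleO_iff]
  intro c hc
  filter_upwards [key (min c 1) (lt_min hc one_pos) (min_le_right _ _)] with x hx
  rw [hfix]
  have : e (φ T (e.symm x)) - o - (ContinuousLinearMap.id ℝ F) (x - o) = e (φ T (e.symm x)) - x := by
    simp
  rw [this]
  exact hx.trans (by gcongr; exact min_le_left _ _)

end RotationFlow

/-! ### Symmetry of mixed second derivatives -/

section SecondDerivative

open Filter Topology

/-- Mixed partial derivatives of a product law commute. -/
theorem fderiv_partial_comm {F : Type*} [NormedAddCommGroup F] [NormedSpace ℝ F]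
    {f : F × F → F} {o v w : F} {V W : F → F} (hf : ContDiffAt ℝ 2 f (o, o))
    (hV : V =ᶠ[𝓝 o] fun x => fderiv ℝ f (x, o) (0, v))
    (hW : W =ᶠ[𝓝 o] fun x => fderiv ℝ f (o, x) (w, 0)) :
    fderiv ℝ V o w = fderiv ℝ W o v := by
  have hd : DifferentiableAt ℝ (fderiv ℝ f) (o, o) :=
    (hf.fderiv_right (m := 1) (by norm_num)).differentiableAt one_ne_zero
  have h1 : HasFDerivAt (fun x : F => (x, o)) (ContinuousLinearMap.inl ℝ F F) o :=
    hasFDerivAt_prodMk_left o o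
  have h2 : HasFDerivAt (fun x : F => (o, x)) (ContinuousLinearMap.inr ℝ F F) o :=
    hasFDerivAt_prodMk_right o o
  have hV' := ((hd.hasFDerivAt.comp (f := fun x : F => (x, o)) o h1).clm_apply
    (hasFDerivAt_const (0, v) o)).congr_of_eventuallyEq hV
  have hW' := ((hd.hasFDerivAt.comp (f := fun x : F => (o, x)) o h2).clm_apply
    (hasFDerivAt_const (w, 0) o)).congr_of_eventuallyEq hW
  have hsymm := hf.isSymmSndFDerivAt (by simp) (w, 0) (0, v)
  rw [hV'.fderiv, hW'.fderiv]
  simpa using hsymm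

end SecondDerivative

/-! ### Vector fields and brackets in a chart -/

section ChartRep

open VectorField Filter Topology Set

variable {n : ℕ} {G : Type*} [TopologicalSpace G]
  [ChartedSpace (EuclideanSpace ℝ (Fin n)) G]

/-- The expression of a vector field in the chart around a point `p`. -/
noncomputable def chartRep (p : G) (V : (g : G) → TangentSpace (𝓡 n) g) :
    EuclideanSpace ℝ (Fin n) → EuclideanSpace ℝ (Fin n) := fun x =>
  mpullbackWithin 𝓘(ℝ, EuclideanSpace ℝ (Fin n)) (𝓡 n) (extChartAt (𝓡 n) p).symm V
    (range (𝓡 n)) x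

theorem chartRep_apply [IsManifold (𝓡 n) 1 G] (p : G) (V : (g : G) → TangentSpace (𝓡 n) g)
    {x : EuclideanSpace ℝ (Fin n)} (hx : x ∈ (extChartAt (𝓡 n) p).target) :
    chartRep p V x = mfderiv (𝓡 n) 𝓘(ℝ, EuclideanSpace ℝ (Fin n)) (extChartAt (𝓡 n) p)
      ((extChartAt (𝓡 n) p).symm x) (V ((extChartAt (𝓡 n) p).symm x)) := by
  rw [chartRep, mpullbackWithin_apply]
  congr 1
  exact ContinuousLinearMap.inverse_eq (mfderivWithin_extChartAt_symm_comp_mfderiv_extChartAt hx)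
    (mfderiv_extChartAt_comp_mfderivWithin_extChartAt_symm hx)

theorem chartRep_base [IsManifold (𝓡 n) 1 G] (p : G) (V : (g : G) → TangentSpace (𝓡 n) g) :
    chartRep p V (extChartAt (𝓡 n) p p) = V p := by
  rw [chartRep_apply p V (mem_extChartAt_target p), extChartAt_to_inv, mfderiv_extChartAt_self]
  rfl

/-- The derivative of the preferred chart at its own base point is the identity, so the coordinate
bracket needs no transport back to the manifold. -/
theorem mlieBracket_eq_chartRep [IsManifold (𝓡 n) 1 G] (p : G)
    (V W : (g : G) → TangentSpace (𝓡 n) g) :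
    mlieBracket (𝓡 n) V W p =
      fderiv ℝ (chartRep p W) (extChartAt (𝓡 n) p p) (V p) -
        fderiv ℝ (chartRep p V) (extChartAt (𝓡 n) p p) (W p) := by
  have hinv : (mfderiv (𝓡 n) 𝓘(ℝ, EuclideanSpace ℝ (Fin n)) (extChartAt (𝓡 n) p) p).inverse =
      (ContinuousLinearMap.id ℝ (EuclideanSpace ℝ (Fin n)) :) := by
    refine (congrArg (fun L : EuclideanSpace ℝ (Fin n) →L[ℝ] EuclideanSpace ℝ (Fin n) => L.inverse)
      (mfderiv_extChartAt_self (I := 𝓡 n) (x := p))).trans ?_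
    exact ContinuousLinearMap.inverse_id
  have hset : (extChartAt (𝓡 n) p).symm ⁻¹' univ ∩ range (𝓡 n) = univ := by simp
  have hbr : mlieBracket (𝓡 n) V W p = lieBracketWithin ℝ (chartRep p V) (chartRep p W)
      ((extChartAt (𝓡 n) p).symm ⁻¹' univ ∩ range (𝓡 n)) (extChartAt (𝓡 n) p p) := by
    rw [← mlieBracketWithin_univ, mlieBracketWithin_apply, hinv]
    rfl
  rw [hset, lieBracketWithin_univ] at hbr
  refine hbr.trans ?_
  rw [lieBracket]
  exact congrArg₂ (fun a b => fderiv ℝ (chartRep p W) (extChartAt (𝓡 n) p p) a -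
    fderiv ℝ (chartRep p V) (extChartAt (𝓡 n) p p) b) (chartRep_base p V) (chartRep_base p W)

theorem differentiableAt_chartRep [IsManifold (𝓡 n) 2 G] {p : G}
    {V : (g : G) → TangentSpace (𝓡 n) g}
    (hV : MDifferentiableAt (𝓡 n) (𝓡 n).tangent (fun g => (⟨g, V g⟩ : TangentBundle (𝓡 n) G)) p) :
    DifferentiableAt ℝ (chartRep p V) (extChartAt (𝓡 n) p p) := by
  have h : DifferentiableWithinAt ℝ (chartRep p V)
      ((extChartAt (𝓡 n) p).symm ⁻¹' univ ∩ range (𝓡 n)) (extChartAt (𝓡 n) p p) :=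
    (mdifferentiableWithinAt_univ.2 hV).differentiableWithinAt_mpullbackWithin_vectorField
  have hset : (extChartAt (𝓡 n) p).symm ⁻¹' univ ∩ range (𝓡 n) = univ := by simp
  rwa [hset, differentiableWithinAt_univ] at h

theorem IsMIntegralCurve.hasDerivAt_extChartAt [IsManifold (𝓡 n) 1 G]
    {V : (g : G) → TangentSpace (𝓡 n) g} {γ : ℝ → G} (hγ : IsMIntegralCurve (I := 𝓡 n) γ V)
    (p : G) {t : ℝ} (ht : γ t ∈ (extChartAt (𝓡 n) p).source) :
    HasDerivAt (fun s => extChartAt (𝓡 n) p (γ s))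
      (chartRep p V (extChartAt (𝓡 n) p (γ t))) t := by
  have hsrc : γ t ∈ (chartAt (EuclideanSpace ℝ (Fin n)) p).source := by
    rwa [extChartAt_source] at ht
  have h : HasFDerivAt (fun s => extChartAt (𝓡 n) p (γ s))
      ((mfderiv (𝓡 n) 𝓘(ℝ, EuclideanSpace ℝ (Fin n)) (extChartAt (𝓡 n) p) (γ t) :
        EuclideanSpace ℝ (Fin n) →L[ℝ] EuclideanSpace ℝ (Fin n)).comp
        ((1 : ℝ →L[ℝ] ℝ).smulRight (V (γ t) : EuclideanSpace ℝ (Fin n)))) t :=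
    hasMFDerivAt_iff_hasFDerivAt.1
      (HasMFDerivAt.comp t (mdifferentiableAt_extChartAt hsrc).hasMFDerivAt (hγ t))
  rw [hasDerivAt_iff_hasFDerivAt]
  refine h.congr_fderiv ?_
  rw [chartRep_apply p V ((extChartAt (𝓡 n) p).map_source ht), (extChartAt (𝓡 n) p).left_inv ht]
  refine ContinuousLinearMap.ext_ring ?_
  exact map_smul (mfderiv (𝓡 n) 𝓘(ℝ, EuclideanSpace ℝ (Fin n)) (extChartAt (𝓡 n) p) (γ t) :
    EuclideanSpace ℝ (Fin n) →L[ℝ] EuclideanSpace ℝ (Fin n)) (1 : ℝ)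
    (V (γ t) : EuclideanSpace ℝ (Fin n))

/-- The derivative of a self-map read in the chart around `p` on both sides. -/
theorem hasFDerivAt_extChartAt_comp_symm [IsManifold (𝓡 n) 1 G] {p : G} {q : G} {f : G → G}
    (hf : MDifferentiableAt (𝓡 n) (𝓡 n) f p) (hfp : f p = q)
    (hp : q ∈ (extChartAt (𝓡 n) p).source) :
    HasFDerivAt (fun x => extChartAt (𝓡 n) p (f ((extChartAt (𝓡 n) p).symm x)))
      ((mfderiv (𝓡 n) 𝓘(ℝ, EuclideanSpace ℝ (Fin n)) (extChartAt (𝓡 n) p) q :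
        EuclideanSpace ℝ (Fin n) →L[ℝ] EuclideanSpace ℝ (Fin n)).comp
        (mfderiv (𝓡 n) (𝓡 n) f p)) (extChartAt (𝓡 n) p p) := by
  subst hfp
  have hsrc : f p ∈ (chartAt (EuclideanSpace ℝ (Fin n)) p).source := by
    rwa [extChartAt_source] at hp
  have h := (HasMFDerivAt.comp p (mdifferentiableAt_extChartAt hsrc).hasMFDerivAt
    hf.hasMFDerivAt).2
  have hset : range (𝓡 n) = univ := by simp
  rw [hset] at h
  exact hasFDerivWithinAt_univ.1 h

theorem mfderiv_eq_id_of_eq_id {f : G → G} (hf : f = id) (p : G) :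
    (mfderiv (𝓡 n) (𝓡 n) f p : EuclideanSpace ℝ (Fin n) →L[ℝ] EuclideanSpace ℝ (Fin n)) =
      ContinuousLinearMap.id ℝ (EuclideanSpace ℝ (Fin n)) := by
  subst hf
  exact mfderiv_id

end ChartRep

/-! ### The group law in a chart at the identity -/

section LieGroupChart

open VectorField Filter Topology Set

variable {n : ℕ} {G : Type*} [TopologicalSpace G]
  [ChartedSpace (EuclideanSpace ℝ (Fin n)) G] [Group G] [LieGroup (𝓡 n) ∞ G]

/-- The multiplication of a Lie group in the chart around the identity. -/
noncomputable def chartMul (n : ℕ) (G : Type*) [TopologicalSpace G]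
    [ChartedSpace (EuclideanSpace ℝ (Fin n)) G] [Group G]
    (q : EuclideanSpace ℝ (Fin n) × EuclideanSpace ℝ (Fin n)) : EuclideanSpace ℝ (Fin n) :=
  extChartAt (𝓡 n) (1 : G) ((extChartAt (𝓡 n) (1 : G)).symm q.1 *
    (extChartAt (𝓡 n) (1 : G)).symm q.2)

theorem contDiffAt_chartMul {x y : EuclideanSpace ℝ (Fin n)}
    (hx : x ∈ (extChartAt (𝓡 n) (1 : G)).target) (hy : y ∈ (extChartAt (𝓡 n) (1 : G)).target)
    (hxy : (extChartAt (𝓡 n) (1 : G)).symm x * (extChartAt (𝓡 n) (1 : G)).symm y ∈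
      (extChartAt (𝓡 n) (1 : G)).source) :
    ContDiffAt ℝ ∞ (chartMul n G) (x, y) := by
  have hsymm : ∀ {z : EuclideanSpace ℝ (Fin n)}, z ∈ (extChartAt (𝓡 n) (1 : G)).target →
      ContMDiffAt 𝓘(ℝ, EuclideanSpace ℝ (Fin n)) (𝓡 n) ∞ (extChartAt (𝓡 n) (1 : G)).symm z :=
    fun hz => ((contMDiffOn_extChartAt_symm (1 : G)) _ hz).contMDiffAt
      ((isOpen_extChartAt_target (1 : G)).mem_nhds hz)
  have h1 : ContMDiffAt 𝓘(ℝ, EuclideanSpace ℝ (Fin n) × EuclideanSpace ℝ (Fin n)) (𝓡 n) ∞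
      (fun q : EuclideanSpace ℝ (Fin n) × EuclideanSpace ℝ (Fin n) =>
        (extChartAt (𝓡 n) (1 : G)).symm q.1) (x, y) :=
    ContMDiffAt.comp (x, y) (hsymm hx) contDiffAt_fst.contMDiffAt
  have h2 : ContMDiffAt 𝓘(ℝ, EuclideanSpace ℝ (Fin n) × EuclideanSpace ℝ (Fin n)) (𝓡 n) ∞
      (fun q : EuclideanSpace ℝ (Fin n) × EuclideanSpace ℝ (Fin n) =>
        (extChartAt (𝓡 n) (1 : G)).symm q.2) (x, y) :=
    ContMDiffAt.comp (x, y) (hsymm hy) contDiffAt_snd.contMDiffAt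
  rw [extChartAt_source] at hxy
  exact (ContMDiffAt.comp (x, y) (contMDiffAt_extChartAt' hxy) (h1.mul h2)).contDiffAt

end LieGroupChart

/-! ### Invariant vector fields at the identity -/

section InvariantFields

variable {n : ℕ} {G : Type*} [TopologicalSpace G]
  [ChartedSpace (EuclideanSpace ℝ (Fin n)) G] [Group G]

/-- The right invariant vector field with value `w` at the identity. -/
noncomputable def rightInvariantVectorField (w : GroupLieAlgebra (𝓡 n) G) (g : G) :
    TangentSpace (𝓡 n) g :=
  (mfderiv (𝓡 n) (𝓡 n) (fun h : G => h * g) 1 w : EuclideanSpace ℝ (Fin n))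

theorem mulInvariantVectorField_one (v : GroupLieAlgebra (𝓡 n) G) :
    mulInvariantVectorField v (1 : G) = v :=
  DFunLike.congr_fun (mfderiv_eq_id_of_eq_id (n := n) (funext one_mul) (1 : G)) v

theorem rightInvariantVectorField_one (v : GroupLieAlgebra (𝓡 n) G) :
    rightInvariantVectorField v (1 : G) = v :=
  DFunLike.congr_fun (mfderiv_eq_id_of_eq_id (n := n) (funext mul_one) (1 : G)) v

end InvariantFields

/-! ### Left and right invariant fields commute at the identity -/

section LieGroupChart

open VectorField Filter Topology Set

variable {n : ℕ} {G : Type*} [TopologicalSpace G]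
  [ChartedSpace (EuclideanSpace ℝ (Fin n)) G] [Group G] [LieGroup (𝓡 n) ∞ G]

theorem chartRep_mulInvariantVectorField (v : GroupLieAlgebra (𝓡 n) G)
    {x : EuclideanSpace ℝ (Fin n)} (hx : x ∈ (extChartAt (𝓡 n) (1 : G)).target) :
    chartRep 1 (mulInvariantVectorField v) x =
      fderiv ℝ (chartMul n G) (x, extChartAt (𝓡 n) (1 : G) 1) (0, v) := by
  have hg := (extChartAt (𝓡 n) (1 : G)).map_target hx
  have hM := (contDiffAt_chartMul (x := x) hx (mem_extChartAt_target (1 : G))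
    (by simpa using hg)).differentiableAt (by simp)
  have h1 := hM.hasFDerivAt.comp (f := fun y => (x, y)) _
    (hasFDerivAt_prodMk_right x (extChartAt (𝓡 n) (1 : G) 1))
  have h2 := hasFDerivAt_extChartAt_comp_symm (p := (1 : G))
    (f := fun h => (extChartAt (𝓡 n) (1 : G)).symm x * h)
    ((contMDiff_mul_left (n := ∞)).mdifferentiable (by simp) 1) (mul_one _) hg
  have h3 := DFunLike.congr_fun (h1.unique h2) (v : EuclideanSpace ℝ (Fin n))
  rw [chartRep_apply 1 _ hx]
  exact h3.symm

theorem chartRep_rightInvariantVectorField (w : GroupLieAlgebra (𝓡 n) G)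
    {x : EuclideanSpace ℝ (Fin n)} (hx : x ∈ (extChartAt (𝓡 n) (1 : G)).target) :
    chartRep 1 (rightInvariantVectorField w) x =
      fderiv ℝ (chartMul n G) (extChartAt (𝓡 n) (1 : G) 1, x) (w, 0) := by
  have hg := (extChartAt (𝓡 n) (1 : G)).map_target hx
  have hM := (contDiffAt_chartMul (y := x) (mem_extChartAt_target (1 : G)) hx
    (by simpa using hg)).differentiableAt (by simp)
  have h1 := hM.hasFDerivAt.comp (f := fun y => (y, x)) _
    (hasFDerivAt_prodMk_left (extChartAt (𝓡 n) (1 : G) 1) x)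
  have h2 := hasFDerivAt_extChartAt_comp_symm (p := (1 : G))
    (f := fun h => h * (extChartAt (𝓡 n) (1 : G)).symm x)
    ((contMDiff_mul_right (n := ∞)).mdifferentiable (by simp) 1) (one_mul _) hg
  have h3 := DFunLike.congr_fun (h1.unique h2) (w : EuclideanSpace ℝ (Fin n))
  rw [chartRep_apply 1 _ hx]
  exact h3.symm

/-- Right invariant and left invariant vector fields commute at the identity. -/
theorem mlieBracket_rightInvariant_mulInvariant_one (w v : GroupLieAlgebra (𝓡 n) G) :
    mlieBracket (𝓡 n) (rightInvariantVectorField w) (mulInvariantVectorField v) (1 : G) = 0 := by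
  have hM : ContDiffAt ℝ ∞ (chartMul n G)
      (extChartAt (𝓡 n) (1 : G) 1, extChartAt (𝓡 n) (1 : G) 1) :=
    contDiffAt_chartMul (mem_extChartAt_target (1 : G)) (mem_extChartAt_target (1 : G)) (by simp)
  have htar := (isOpen_extChartAt_target (I := 𝓡 n) (1 : G)).mem_nhds
    (mem_extChartAt_target (1 : G))
  rw [mlieBracket_eq_chartRep, rightInvariantVectorField_one, mulInvariantVectorField_one]
  -- Each invariant field is a partial derivative of the group law, so the bracket is the difference
  -- of its two mixed second derivatives at the identity.
  refine sub_eq_zero.2 (fderiv_partial_comm (hM.of_le ENat.LEInfty.out) ?_ ?_)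
  · filter_upwards [htar] with x hx using chartRep_mulInvariantVectorField v hx
  · filter_upwards [htar] with x hx using chartRep_rightInvariantVectorField w hx

end LieGroupChart

/-! ### Elementary properties of linear flows -/

section LinearVectorField

open VectorField Filter Topology Set

variable {n : ℕ} {G : Type*} [TopologicalSpace G]
  [ChartedSpace (EuclideanSpace ℝ (Fin n)) G] [Group G] [LieGroup (𝓡 n) ∞ G]
  {𝒳 : (g : G) → TangentSpace (𝓡 n) g} {φ : ℝ → G → G}

theorem IsLinearFlow.map_mul (h : IsLinearFlow 𝒳 φ) (t : ℝ) (a b : G) :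
    φ t (a * b) = φ t a * φ t b := by
  obtain ⟨e, he, -⟩ := h.automorphism t
  rw [← he, ← he, ← he, e.map_mul]

theorem IsLinearFlow.map_one (h : IsLinearFlow 𝒳 φ) (t : ℝ) : φ t (1 : G) = 1 := by
  obtain ⟨e, he, -⟩ := h.automorphism t
  rw [← he, e.map_one]

theorem IsLinearFlow.contMDiff (h : IsLinearFlow 𝒳 φ) (t : ℝ) :
    ContMDiff (𝓡 n) (𝓡 n) ∞ (φ t) := by
  obtain ⟨e, he, hs, -⟩ := h.automorphism t
  rwa [show (e : G → G) = φ t from funext he] at hs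

theorem IsLinearFlow.continuous (h : IsLinearFlow 𝒳 φ) (g : G) : Continuous fun t => φ t g :=
  (h.integralCurve g).continuous

/-- A vector field with a constant integral curve vanishes at this point. -/
theorem IsMIntegralCurve.eq_zero_of_const {M : Type*} [TopologicalSpace M]
    [ChartedSpace (EuclideanSpace ℝ (Fin n)) M] {V : (g : M) → TangentSpace (𝓡 n) g}
    {γ : ℝ → M} {p : M} (hγ : IsMIntegralCurve (I := 𝓡 n) γ V) (hc : ∀ t, γ t = p) : V p = 0 := by
  obtain rfl : γ = fun _ => p := funext hc
  have h : (1 : ℝ →L[ℝ] ℝ).smulRight (V p : EuclideanSpace ℝ (Fin n)) =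
      (0 : ℝ →L[ℝ] EuclideanSpace ℝ (Fin n)) :=
    hasMFDerivAt_unique (hγ 0) (hasMFDerivAt_const p (0 : ℝ))
  simpa using! DFunLike.congr_fun h 1

theorem IsLinearFlow.apply_one (h : IsLinearFlow 𝒳 φ) : 𝒳 1 = 0 :=
  (h.integralCurve 1).eq_zero_of_const h.map_one

end LinearVectorField

/-! ### Derivatives of translations and the product rule -/

section TangentMap

variable (n : ℕ) {G : Type*} [TopologicalSpace G] [ChartedSpace (EuclideanSpace ℝ (Fin n)) G]

/-- The derivative of a self-map as an endomorphism of the model space, all tangent spaces being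
definitionally equal to it. -/
noncomputable def modelDeriv (f : G → G) (p : G) :
    EuclideanSpace ℝ (Fin n) →L[ℝ] EuclideanSpace ℝ (Fin n) :=
  mfderiv (𝓡 n) (𝓡 n) f p

variable {n}

theorem modelDeriv_comp {f g : G → G} {p q : G} (hq : g p = q)
    (hf : MDifferentiableAt (𝓡 n) (𝓡 n) f q) (hg : MDifferentiableAt (𝓡 n) (𝓡 n) g p) :
    modelDeriv n (fun x => f (g x)) p = (modelDeriv n f q).comp (modelDeriv n g p) := by
  subst hq
  exact mfderiv_comp p hf hg

theorem modelDeriv_eq_id {f : G → G} (hf : f = id) (p : G) :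
    modelDeriv n f p = ContinuousLinearMap.id ℝ (EuclideanSpace ℝ (Fin n)) :=
  mfderiv_eq_id_of_eq_id hf p

variable [Group G] [LieGroup (𝓡 n) ∞ G]

theorem mdifferentiable_mul_left_self (a : G) : MDifferentiable (𝓡 n) (𝓡 n) (a * ·) :=
  (contMDiff_mul_left (n := ∞)).mdifferentiable (by simp)

theorem mdifferentiable_mul_right_self (a : G) : MDifferentiable (𝓡 n) (𝓡 n) (· * a) :=
  (contMDiff_mul_right (n := ∞)).mdifferentiable (by simp)

theorem modelDeriv_mul_left_mul_left (a b c : G) (u : EuclideanSpace ℝ (Fin n)) :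
    modelDeriv n (a * ·) (b * c) (modelDeriv n (b * ·) c u) = modelDeriv n (a * b * ·) c u := by
  have h := modelDeriv_comp (n := n) (f := (a * ·)) (g := (b * ·)) (p := c) rfl
    (mdifferentiable_mul_left_self a _) (mdifferentiable_mul_left_self b _)
  simp only [← mul_assoc] at h
  rw [h]
  rfl

theorem modelDeriv_mul_left_mul_right (a x b : G) (u : EuclideanSpace ℝ (Fin n)) :
    modelDeriv n (a * ·) (x * b) (modelDeriv n (· * b) x u) =
      modelDeriv n (· * b) (a * x) (modelDeriv n (a * ·) x u) := by
  have h1 := modelDeriv_comp (n := n) (f := (a * ·)) (g := (· * b)) (p := x) rfl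
    (mdifferentiable_mul_left_self a _) (mdifferentiable_mul_right_self b _)
  have h2 := modelDeriv_comp (n := n) (f := (· * b)) (g := (a * ·)) (p := x) rfl
    (mdifferentiable_mul_right_self b _) (mdifferentiable_mul_left_self a _)
  simp only [mul_assoc] at h2
  exact DFunLike.congr_fun (h1.symm.trans h2) u

theorem modelDeriv_mul_left_inv_mul_left (a x : G) (u : EuclideanSpace ℝ (Fin n)) :
    modelDeriv n (a⁻¹ * ·) (a * x) (modelDeriv n (a * ·) x u) = u := by
  rw [modelDeriv_mul_left_mul_left, modelDeriv_eq_id (by ext; simp)]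
  rfl

theorem modelDeriv_mul_left_mul_left_inv (a x : G) (u : EuclideanSpace ℝ (Fin n)) :
    modelDeriv n (a * ·) x (modelDeriv n (a⁻¹ * ·) (a * x) u) = u := by
  have h := modelDeriv_mul_left_mul_left a a⁻¹ (a * x) u
  rwa [modelDeriv_eq_id (f := (a * a⁻¹ * ·)) (by ext; simp), inv_mul_cancel_left] at h

/-- Product rule for two integral curves whose product is an integral curve. -/
theorem apply_mul_of_isMIntegralCurve {V : (g : G) → TangentSpace (𝓡 n) g} {α β : ℝ → G}
    (hα : IsMIntegralCurve (I := 𝓡 n) α V) (hβ : IsMIntegralCurve (I := 𝓡 n) β V)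
    (hγ : IsMIntegralCurve (I := 𝓡 n) (fun t => α t * β t) V) {a b : G} (ha : α 0 = a)
    (hb : β 0 = b) :
    (V (a * b) : EuclideanSpace ℝ (Fin n)) =
      modelDeriv n (· * b) a (V a) + modelDeriv n (a * ·) b (V b) := by
  subst ha hb
  have hm : MDifferentiableAt ((𝓡 n).prod (𝓡 n)) (𝓡 n) (fun p : G × G => p.1 * p.2)
      (α 0, β 0) := (contMDiff_mul (𝓡 n) ∞).mdifferentiable (by simp) _
  have h := HasMFDerivAt.comp (0 : ℝ) hm.hasMFDerivAt ((hα 0).prodMk (hβ 0))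
  have h1 := hasMFDerivAt_unique (hγ 0) h
  have h2 : (V (α 0 * β 0) : EuclideanSpace ℝ (Fin n)) =
      (mfderiv ((𝓡 n).prod (𝓡 n)) (𝓡 n) (fun p : G × G => p.1 * p.2) (α 0, β 0) :
        EuclideanSpace ℝ (Fin n) × EuclideanSpace ℝ (Fin n) →L[ℝ] EuclideanSpace ℝ (Fin n))
        (V (α 0), V (β 0)) := by
    have h3 : (1 : ℝ) • (V (α 0 * β 0) : EuclideanSpace ℝ (Fin n)) =
      (mfderiv ((𝓡 n).prod (𝓡 n)) (𝓡 n) (fun p : G × G => p.1 * p.2) (α 0, β 0) :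
        EuclideanSpace ℝ (Fin n) × EuclideanSpace ℝ (Fin n) →L[ℝ] EuclideanSpace ℝ (Fin n))
        ((1 : ℝ) • (V (α 0) : EuclideanSpace ℝ (Fin n)),
          (1 : ℝ) • (V (β 0) : EuclideanSpace ℝ (Fin n))) := DFunLike.congr_fun h1 (1 : ℝ)
    rwa [one_smul, one_smul, one_smul] at h3
  rw [h2]
  exact mfderiv_prod_eq_add_apply hm

end TangentMap

/-! ### The derivation attached to a linear vector field -/

section AssociatedDerivation

open VectorField Filter Topology Set

variable {n : ℕ} {G : Type*} [TopologicalSpace G]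
  [ChartedSpace (EuclideanSpace ℝ (Fin n)) G] [Group G] [LieGroup (𝓡 n) ∞ G]
  {𝒳 : (g : G) → TangentSpace (𝓡 n) g} {φ : ℝ → G → G}

/-- A linear vector field is infinitesimally multiplicative. -/
theorem IsLinearFlow.apply_mul (h : IsLinearFlow 𝒳 φ) (a b : G) :
    (𝒳 (a * b) : EuclideanSpace ℝ (Fin n)) =
      modelDeriv n (· * b) a (𝒳 a) + modelDeriv n (a * ·) b (𝒳 b) := by
  refine apply_mul_of_isMIntegralCurve (h.integralCurve a) (h.integralCurve b) ?_ (h.map_zero a)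
    (h.map_zero b)
  have := h.integralCurve (a * b)
  simpa only [h.map_mul] using this

theorem mpullback_mul_left_apply (a x : G) (V : (g : G) → TangentSpace (𝓡 n) g) :
    (mpullback (𝓡 n) (𝓡 n) (a * ·) V x : EuclideanSpace ℝ (Fin n)) =
      modelDeriv n (a⁻¹ * ·) (a * x) (V (a * x)) :=
  DFunLike.congr_fun (inverse_mfderiv_mul_left (I := 𝓡 n) (g := a) (h := x)) (V (a * x))

/-- The pullback of a linear vector field by a left translation differs from it by a right
invariant vector field. -/
theorem IsLinearFlow.mpullback_mul_left (h : IsLinearFlow 𝒳 φ) (a : G) :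
    mpullback (𝓡 n) (𝓡 n) (a * ·) 𝒳 =
      𝒳 + rightInvariantVectorField
        (modelDeriv n (a⁻¹ * ·) a (𝒳 a) : EuclideanSpace ℝ (Fin n)) := by
  ext1 x
  -- Undoing the left translation recovers `q`; on the other term it commutes with right translation
  -- by `x`, leaving a right invariant field.
  have key : ∀ p q : EuclideanSpace ℝ (Fin n), modelDeriv n (a⁻¹ * ·) (a * x)
      (modelDeriv n (· * x) a p + modelDeriv n (a * ·) x q) =
      q + modelDeriv n (· * x) 1 (modelDeriv n (a⁻¹ * ·) a p) := fun p q => by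
    rw [map_add, modelDeriv_mul_left_inv_mul_left, modelDeriv_mul_left_mul_right, inv_mul_cancel,
      add_comm]
  refine (mpullback_mul_left_apply a x 𝒳).trans ?_
  rw [h.apply_mul]
  exact key (𝒳 a) (𝒳 x)

theorem IsLinearFlow.mdifferentiableAt (h : IsLinearFlow 𝒳 φ) (g : G) :
    MDifferentiableAt (𝓡 n) (𝓡 n).tangent (fun g => (⟨g, 𝒳 g⟩ : TangentBundle (𝓡 n) G)) g :=
  h.smooth.mdifferentiable (by simp) g

theorem isInvertible_mfderiv_mul_left (a x : G) :
    (mfderiv (𝓡 n) (𝓡 n) (a * ·) x).IsInvertible := by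
  refine ContinuousLinearMap.IsInvertible.of_inverse
    (g := (modelDeriv n (a⁻¹ * ·) (a * x) :)) ?_ ?_
  · ext1 u
    exact modelDeriv_mul_left_mul_left_inv a x u
  · ext1 u
    exact modelDeriv_mul_left_inv_mul_left a x u

/-- The bracket of a linear vector field and a left invariant one is left invariant. -/
theorem IsLinearFlow.mulInvariantVectorField_mlieBracket (h : IsLinearFlow 𝒳 φ)
    (v : GroupLieAlgebra (𝓡 n) G) :
    mulInvariantVectorField (mlieBracket (𝓡 n) 𝒳 (mulInvariantVectorField v) 1) =
      mlieBracket (𝓡 n) 𝒳 (mulInvariantVectorField v) := by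
  ext1 a
  set W := mlieBracket (𝓡 n) 𝒳 (mulInvariantVectorField v)
  have hL : ContMDiffAt (𝓡 n) (𝓡 n) ∞ (a * ·) (1 : G) := contMDiff_mul_left.contMDiffAt
  have hpb : mpullback (𝓡 n) (𝓡 n) (a * ·) W 1 = W 1 := by
    set w : GroupLieAlgebra (𝓡 n) G :=
      (modelDeriv n (a⁻¹ * ·) a (𝒳 a) : EuclideanSpace ℝ (Fin n))
    have hP := (h.mdifferentiableAt (a * 1)).mpullback_vectorField hL
      (isInvertible_mfderiv_mul_left a 1) ENat.LEInfty.out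
    -- The right invariant field inherits differentiability as the difference between the pullback
    -- of `𝒳` and `𝒳`.
    have hR : MDifferentiableAt (𝓡 n) (𝓡 n).tangent
        (fun g => (⟨g, rightInvariantVectorField w g⟩ : TangentBundle (𝓡 n) G)) 1 := by
      have := mdifferentiableAt_sub_section hP (h.mdifferentiableAt 1)
      rwa [h.mpullback_mul_left a, add_sub_cancel_left] at this
    -- With `R` the right invariant correction, the pullback of `[𝒳, Y]` at `1` is `[𝒳 + R, Y] = [𝒳,
    -- Y] + [R, Y]`, and the last term vanishes.
    rw [mpullback_mlieBracket (n := ∞) (h.mdifferentiableAt _)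
      (mdifferentiableAt_mulInvariantVectorField v) hL (by simpa using ENat.LEInfty.out),
      mpullback_mulInvariantVectorField, h.mpullback_mul_left a,
      mlieBracket_add_left (h.mdifferentiableAt 1) hR,
      mlieBracket_rightInvariant_mulInvariant_one, add_zero]
  have h1 := congrArg (modelDeriv n (a * ·) 1) ((mpullback_mul_left_apply a 1 W).symm.trans hpb)
  have h2 : modelDeriv n (a * ·) 1 (W 1) = W (a * 1) :=
    h1.symm.trans (modelDeriv_mul_left_mul_left_inv a 1 (W (a * 1)))
  rw [mul_one] at h2
  exact h2

/-- The derivation `Y ↦ -[𝒳, Y]` defined by a linear vector field. -/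
noncomputable def IsLinearFlow.derivation (h : IsLinearFlow 𝒳 φ) :
    LieDerivation ℝ (GroupLieAlgebra (𝓡 n) G) (GroupLieAlgebra (𝓡 n) G) where
  toFun v := -mlieBracket (𝓡 n) 𝒳 (mulInvariantVectorField v) 1
  map_add' v w := by
    rw [mulInvariantVectorField_add, mlieBracket_add_right
      (mdifferentiableAt_mulInvariantVectorField v) (mdifferentiableAt_mulInvariantVectorField w),
      neg_add]
  map_smul' c v := by
    rw [mulInvariantVectorField_smul, mlieBracket_const_smul_right
      (mdifferentiableAt_mulInvariantVectorField v), smul_neg, RingHom.id_apply]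
  leibniz' v w := by
    have hle : minSmoothness ℝ 2 ≤ ∞ := by simpa using ENat.LEInfty.out
    -- The Leibniz rule is the Jacobi identity for `𝒳` and two left invariant fields; left
    -- invariance of `[𝒳, Y]` identifies the inner brackets with elements of the Lie algebra.
    have hleib := leibniz_identity_mlieBracket_apply (I := 𝓡 n) (U := 𝒳)
      (V := mulInvariantVectorField v) (W := mulInvariantVectorField w) (x := 1)
      (h.smooth.contMDiffAt.of_le hle) (contMDiffAt_mulInvariantVectorField v)
      (contMDiffAt_mulInvariantVectorField w)
    change -mlieBracket (𝓡 n) 𝒳 (mulInvariantVectorField ⁅v, w⁆) 1 =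
      ⁅v, -mlieBracket (𝓡 n) 𝒳 (mulInvariantVectorField w) 1⁆ -
      ⁅w, -mlieBracket (𝓡 n) 𝒳 (mulInvariantVectorField v) 1⁆
    rw [lie_neg, lie_neg, ← lie_skew w, neg_neg]
    simp only [GroupLieAlgebra.bracket_def, mulInvariantVector_mlieBracket,
      h.mulInvariantVectorField_mlieBracket, hleib]
    abel

theorem IsLinearFlow.isAssociatedDerivation (h : IsLinearFlow 𝒳 φ) :
    IsAssociatedDerivation 𝒳 h.derivation := by
  intro v g
  have h1 : h.derivation v =
      (-1 : ℝ) • mlieBracket (𝓡 n) 𝒳 (mulInvariantVectorField v) 1 := (neg_one_smul ℝ _).symm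
  rw [h1, mulInvariantVectorField_smul, h.mulInvariantVectorField_mlieBracket, neg_one_smul]
  rfl

end AssociatedDerivation

/-! ### Endomorphisms are determined by their derivative at the identity -/

section Rigidity

open Filter Topology Set

variable {n : ℕ} {G : Type*} [TopologicalSpace G]
  [ChartedSpace (EuclideanSpace ℝ (Fin n)) G]

/-- A map with zero derivative is locally constant. -/
theorem eventually_eq_of_hasMFDerivAt_zero [IsManifold (𝓡 n) 1 G] {q : G → G}
    (hq : ∀ g, HasMFDerivAt (𝓡 n) (𝓡 n) q g
      (0 : EuclideanSpace ℝ (Fin n) →L[ℝ] EuclideanSpace ℝ (Fin n))) {p : G} (hp : q p = p) :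
    ∀ᶠ g in 𝓝 p, q g = p := by
  set ψ := extChartAt (𝓡 n) p
  have hqc : Continuous q := continuous_iff_continuousAt.2 fun g => (hq g).continuousAt
  have hU : ψ.target ∩ ψ.symm ⁻¹' (q ⁻¹' ψ.source) ∈ 𝓝 (ψ p) := by
    refine inter_mem ((isOpen_extChartAt_target p).mem_nhds (mem_extChartAt_target p)) ?_
    refine (continuousAt_extChartAt_symm p).preimage_mem_nhds ?_
    rw [extChartAt_to_inv]
    refine hqc.continuousAt.preimage_mem_nhds ?_
    rw [hp]
    exact extChartAt_source_mem_nhds p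
  obtain ⟨r, hr, hball⟩ := Metric.mem_nhds_iff.1 hU
  have hd : ∀ x ∈ Metric.ball (ψ p) r, HasFDerivAt (fun x => ψ (q (ψ.symm x)))
      (0 : EuclideanSpace ℝ (Fin n) →L[ℝ] EuclideanSpace ℝ (Fin n)) x := by
    intro x hx
    obtain ⟨hxt, hxs⟩ := hball hx
    have hsrc : q (ψ.symm x) ∈ (chartAt (EuclideanSpace ℝ (Fin n)) p).source := by
      rw [← extChartAt_source (𝓡 n)]
      exact hxs
    have hsymm : MDifferentiableAt 𝓘(ℝ, EuclideanSpace ℝ (Fin n)) (𝓡 n) ψ.symm x :=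
      ((contMDiffOn_extChartAt_symm (n := 1) p).contMDiffAt
        ((isOpen_extChartAt_target p).mem_nhds hxt)).mdifferentiableAt one_ne_zero
    have h := HasMFDerivAt.comp x (HasMFDerivAt.comp (ψ.symm x)
      (mdifferentiableAt_extChartAt hsrc).hasMFDerivAt (hq (ψ.symm x))) hsymm.hasMFDerivAt
    refine (hasMFDerivAt_iff_hasFDerivAt.1 h).congr_fderiv ?_
    ext1 u
    exact map_zero (mfderiv (𝓡 n) 𝓘(ℝ, EuclideanSpace ℝ (Fin n)) ψ (q (ψ.symm x)) :
      EuclideanSpace ℝ (Fin n) →L[ℝ] EuclideanSpace ℝ (Fin n))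
  have hconst : ∀ x ∈ Metric.ball (ψ p) r, ψ (q (ψ.symm x)) = ψ p := by
    intro x hx
    have h1 := (convex_ball (ψ p) r).is_const_of_fderivWithin_eq_zero (𝕜 := ℝ)
      (f := fun x => ψ (q (ψ.symm x)))
      (fun y hy => (hd y hy).differentiableAt.differentiableWithinAt)
      (fun y hy => (hd y hy).hasFDerivWithinAt.fderivWithin
        (Metric.isOpen_ball.uniqueDiffWithinAt hy)) hx (Metric.mem_ball_self hr)
    simpa only [ψ, extChartAt_to_inv, hp] using h1
  filter_upwards [(continuousAt_extChartAt (I := 𝓡 n) p).preimage_mem_nhds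
    (Metric.ball_mem_nhds _ hr), extChartAt_source_mem_nhds (I := 𝓡 n) p] with g hg hgs
  have h1 := hconst _ hg
  have h2 := (hball hg).2
  rw [mem_preimage, mem_preimage, ψ.left_inv hgs] at h2
  rw [ψ.left_inv hgs] at h1
  exact ψ.injOn h2 (mem_extChartAt_source p) h1

variable [Group G] [LieGroup (𝓡 n) ∞ G]

/-- For a smooth endomorphism `f` whose derivative at the identity is the identity, the map
`g ↦ f g * g⁻¹` has zero derivative. -/
theorem hasMFDerivAt_map_mul_inv {f : G →* G} (hf : MDifferentiable (𝓡 n) (𝓡 n) f)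
    (hf1 : modelDeriv n f 1 = ContinuousLinearMap.id ℝ (EuclideanSpace ℝ (Fin n))) (g : G) :
    HasMFDerivAt (𝓡 n) (𝓡 n) (fun x => f x * x⁻¹) g
      (0 : EuclideanSpace ℝ (Fin n) →L[ℝ] EuclideanSpace ℝ (Fin n)) := by
  have hm : MDifferentiable ((𝓡 n).prod (𝓡 n)) (𝓡 n) (fun p : G × G => p.1 * p.2) :=
    (contMDiff_mul (𝓡 n) ∞).mdifferentiable (by simp)
  have hi : MDifferentiable (𝓡 n) (𝓡 n) (fun x : G => x⁻¹) :=
    (contMDiff_inv (𝓡 n) ∞).mdifferentiable (by simp)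
  have hq : ∀ k : G → G, MDifferentiable (𝓡 n) (𝓡 n) k →
      MDifferentiable (𝓡 n) (𝓡 n) (fun x => k x * x⁻¹) := fun k hk x =>
    (hm (k x, x⁻¹)).comp x ((hk x).prodMk (hi x))
  -- At `1` the derivative of `k x * x⁻¹` depends on `k` only through `k 1 = 1` and its derivative
  -- there. So `f` may be replaced by the identity map, for which the product is constant.
  have hone : ∀ k : G → G, MDifferentiable (𝓡 n) (𝓡 n) k → k 1 = 1 →
      modelDeriv n k 1 = ContinuousLinearMap.id ℝ (EuclideanSpace ℝ (Fin n)) →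
      modelDeriv n (fun x => k x * x⁻¹) 1 =
        (mfderiv ((𝓡 n).prod (𝓡 n)) (𝓡 n) (fun p : G × G => p.1 * p.2) (1, 1⁻¹) :
          EuclideanSpace ℝ (Fin n) × EuclideanSpace ℝ (Fin n) →L[ℝ]
            EuclideanSpace ℝ (Fin n)).comp
        ((ContinuousLinearMap.id ℝ (EuclideanSpace ℝ (Fin n))).prod
          (modelDeriv n (fun x : G => x⁻¹) 1)) := by
    intro k hk hk1 hdk
    have h := (HasMFDerivAt.comp (1 : G) (hm (k 1, 1⁻¹)).hasMFDerivAt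
      ((hk 1).hasMFDerivAt.prodMk (hi 1).hasMFDerivAt)).mfderiv
    rw [← hdk]
    have hc : ∀ a : G, a = 1 →
        (mfderiv ((𝓡 n).prod (𝓡 n)) (𝓡 n) (fun p : G × G => p.1 * p.2) (a, 1⁻¹) :
          EuclideanSpace ℝ (Fin n) × EuclideanSpace ℝ (Fin n) →L[ℝ]
            EuclideanSpace ℝ (Fin n)) =
        (mfderiv ((𝓡 n).prod (𝓡 n)) (𝓡 n) (fun p : G × G => p.1 * p.2) (1, 1⁻¹) :
          EuclideanSpace ℝ (Fin n) × EuclideanSpace ℝ (Fin n) →L[ℝ]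
            EuclideanSpace ℝ (Fin n)) := by
      rintro _ rfl
      rfl
    rw [← hc (k 1) hk1]
    exact h
  have hzero : modelDeriv n (fun x => f x * x⁻¹) 1 = 0 := by
    rw [hone f hf (map_one f) hf1, ← hone id mdifferentiable_id rfl (modelDeriv_eq_id rfl 1)]
    simp only [id, mul_inv_cancel]
    exact mfderiv_const
  -- Multiplicativity of `f` transports the vanishing of the derivative from `1` to `g` by
  -- translations.
  have hcomp : (fun x => f x * x⁻¹) = fun x => f g * ((f (g⁻¹ * x) * (g⁻¹ * x)⁻¹) * g⁻¹) := by
    ext x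
    simp [mul_assoc]
  have h1 : modelDeriv n (fun x => f (g⁻¹ * x) * (g⁻¹ * x)⁻¹) g = 0 := by
    have := modelDeriv_comp (n := n) (f := fun x => f x * x⁻¹) (g := (g⁻¹ * ·)) (p := g)
      (inv_mul_cancel g) (hq f hf 1) (mdifferentiable_mul_left_self g⁻¹ g)
    rw [this, hzero, ContinuousLinearMap.zero_comp]
  have hd1 : MDifferentiable (𝓡 n) (𝓡 n) (fun x => f (g⁻¹ * x) * (g⁻¹ * x)⁻¹) :=
    (hq f hf).comp (mdifferentiable_mul_left_self g⁻¹)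
  have h2 : modelDeriv n (fun x => f x * x⁻¹) g = 0 := by
    rw [hcomp]
    have e1 := modelDeriv_comp (n := n) (f := fun y => f g * (y * g⁻¹))
      (g := fun x => f (g⁻¹ * x) * (g⁻¹ * x)⁻¹) (p := g) rfl
      (((mdifferentiable_mul_left_self (f g)).comp (mdifferentiable_mul_right_self g⁻¹)) _) (hd1 g)
    rw [e1, h1, ContinuousLinearMap.comp_zero]
  have h3 := (hq f hf g).hasMFDerivAt
  exact h3.congr_mfderiv h2

/-- A smooth endomorphism of a connected Lie group whose derivative at the identity is the identity
is the identity. -/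
theorem eq_of_modelDeriv_one_eq_id [PreconnectedSpace G] {f : G →* G}
    (hf : MDifferentiable (𝓡 n) (𝓡 n) f)
    (hf1 : modelDeriv n f 1 = ContinuousLinearMap.id ℝ (EuclideanSpace ℝ (Fin n))) (g : G) :
    f g = g := by
  have : IsTopologicalGroup G := topologicalGroup_of_lieGroup (𝓡 n) ∞
  have hnear : ∀ᶠ g in 𝓝 (1 : G), f g * g⁻¹ = 1 :=
    eventually_eq_of_hasMFDerivAt_zero (hasMFDerivAt_map_mul_inv hf hf1) (by simp)
  -- The fixed points of `f` form a subgroup containing a neighbourhood of `1`; such a subgroup is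
  -- open and closed, hence everything by connectedness.
  have hopen : IsOpen (f.eqLocus (MonoidHom.id G) : Set G) := by
    refine Subgroup.isOpen_of_mem_nhds _ (g := 1) ?_
    filter_upwards [hnear] with g hg
    exact mul_inv_eq_one.1 hg
  have huniv := IsClopen.eq_univ ⟨Subgroup.isClosed_of_isOpen _ hopen, hopen⟩ ⟨1, one_mem _⟩
  exact (huniv ▸ mem_univ g : g ∈ (f.eqLocus (MonoidHom.id G) : Set G))

end Rigidity

/-! ### Periodicity of the flow -/

section PeriodicFlow

open VectorField Filter Topology Set

variable {n : ℕ} {G : Type*} [TopologicalSpace G]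
  [ChartedSpace (EuclideanSpace ℝ (Fin n)) G] [Group G] [LieGroup (𝓡 n) ∞ G]
  {𝒳 : (g : G) → TangentSpace (𝓡 n) g} {φ : ℝ → G → G}

/-- Since `𝒳 1 = 0`, only the term differentiating `𝒳` survives in the coordinate bracket, and its
sign cancels the one in `-[𝒳, Y]`. -/
theorem IsLinearFlow.derivation_apply (h : IsLinearFlow 𝒳 φ) (v : GroupLieAlgebra (𝓡 n) G) :
    h.derivation v = fderiv ℝ (chartRep 1 𝒳) (extChartAt (𝓡 n) (1 : G) 1) v := by
  have h1 := mlieBracket_eq_chartRep 1 𝒳 (mulInvariantVectorField v)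
  have h2 := _root_.map_zero (fderiv ℝ (chartRep 1 (mulInvariantVectorField v))
    (extChartAt (𝓡 n) (1 : G) 1))
  rw [h.apply_one, mulInvariantVectorField_one] at h1
  refine (congrArg (fun u : EuclideanSpace ℝ (Fin n) => -u) (h1.trans
    (congrArg (fun u : EuclideanSpace ℝ (Fin n) =>
      u - fderiv ℝ (chartRep 1 𝒳) (extChartAt (𝓡 n) (1 : G) 1) v) h2))).trans ?_
  simp only [zero_sub, neg_neg]

/-- The proof gives more than one closed orbit: `φ (2π/ν)` is the identity of `G`, so any point that
is not fixed will do. -/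
theorem IsLinearFlow.hasPeriodicOrbit (h : IsLinearFlow 𝒳 φ) [PreconnectedSpace G] {ν : ℝ}
    (hν : 0 < ν) (hne : h.derivation.toLinearMap ≠ 0)
    (hD : ∀ v, h.derivation (h.derivation (h.derivation v)) = -(ν ^ 2) • h.derivation v) :
    HasPeriodicOrbit φ := by
  have : IsTopologicalGroup G := topologicalGroup_of_lieGroup (𝓡 n) ∞
  -- A `T1` topological group is Hausdorff, as the chart estimate requires.
  have : T1Space G := ChartedSpace.t1Space (EuclideanSpace ℝ (Fin n)) G
  set A := fderiv ℝ (chartRep 1 𝒳) (extChartAt (𝓡 n) (1 : G) 1)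
  have hA : A ^ 3 = -(ν ^ 2) • A := by
    ext1 v
    have e1 := h.derivation_apply v
    have e2 := (h.derivation_apply (h.derivation v)).trans (congrArg A e1)
    have e3 := (h.derivation_apply (h.derivation (h.derivation v))).trans (congrArg A e2)
    exact e3.symm.trans ((hD v).trans
      (congrArg (fun u : EuclideanSpace ℝ (Fin n) => -(ν ^ 2) • u) e1))
  have hφT := hasFDerivAt_flow_period (chartAt (EuclideanSpace ℝ (Fin n)) (1 : G))
    (mem_chart_target _ _) hν hA (differentiableAt_chartRep (h.mdifferentiableAt 1)).hasFDerivAt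
    ((chartRep_base 1 𝒳).trans h.apply_one) h.map_zero h.continuous fun g t ht =>
      (h.integralCurve g).hasDerivAt_extChartAt 1 (by rwa [extChartAt_source])
  set T := 2 * Real.pi / ν
  have hT : 0 < T := by positivity
  have hmd : MDifferentiable (𝓡 n) (𝓡 n) (φ T) := (h.contMDiff T).mdifferentiable (by simp)
  have hder : modelDeriv n (φ T) 1 = ContinuousLinearMap.id ℝ (EuclideanSpace ℝ (Fin n)) := by
    have h1 := hasFDerivAt_extChartAt_comp_symm (hmd 1) (h.map_one T)
      (mem_extChartAt_source (I := 𝓡 n) (1 : G))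
    have h2 := hφT.unique h1
    ext1 v
    have h3 := DFunLike.congr_fun h2 v
    have h4 := DFunLike.congr_fun (mfderiv_extChartAt_self (I := 𝓡 n) (x := (1 : G)))
      (modelDeriv n (φ T) 1 v)
    exact h4.symm.trans h3.symm
  have hid : ∀ g, φ T g = g := fun g =>
    eq_of_modelDeriv_one_eq_id (f := ⟨⟨φ T, h.map_one T⟩, h.map_mul T⟩) hmd hder g
  have hnf : ∃ g, ∃ t, φ t g ≠ g := by
    by_contra! hcon
    -- If every point were fixed, `𝒳` and hence the derivation would vanish.
    have hX : 𝒳 = 0 := by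
      ext1 g
      exact (h.integralCurve g).eq_zero_of_const (hcon g)
    refine hne (LinearMap.ext fun v => ?_)
    change -mlieBracket (𝓡 n) 𝒳 (mulInvariantVectorField v) 1 = 0
    rw [hX, mlieBracket_zero_left]
    exact neg_zero
  obtain ⟨g, hg⟩ := hnf
  refine ⟨g, hg, T, hT, fun t => ?_⟩
  -- By uniqueness of integral curves, `φ T g = φ 0 g` propagates to all times.
  have hper := (h.integralCurve g).periodic_of_eq (a := T) (b := 0)
    (h.smooth.of_le ENat.LEInfty.out) ((hid g).trans (h.map_zero g).symm)
  simpa using hper t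

end PeriodicFlow

theorem mainTheorem9 {G : Type*} [TopologicalSpace G]
    [ChartedSpace (EuclideanSpace ℝ (Fin 3)) G] [Group G] [LieGroup (𝓡 3) ∞ G]
    [SimplyConnectedSpace G]
    (E : Module.Basis (Fin 3) ℝ (GroupLieAlgebra (𝓡 3) G)) (hE : IsTypeG31Basis E) :
    (∀ D : GroupLieAlgebra (𝓡 3) G →ₗ[ℝ] GroupLieAlgebra (𝓡 3) G,
      (∃ δ : LieDerivation ℝ (GroupLieAlgebra (𝓡 3) G) (GroupLieAlgebra (𝓡 3) G),
        δ.toLinearMap = D) ↔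
      ∃ x₂ x₃ y₂ y₃ z₂ z₃ : ℝ, LinearMap.toMatrix E E D = g31Block x₂ x₃ y₂ y₃ z₂ z₃) ∧
    (∀ (𝒳 : (g : G) → TangentSpace (𝓡 3) g) (φ : ℝ → G → G), IsLinearFlow 𝒳 φ →
      ∃ D : LieDerivation ℝ (GroupLieAlgebra (𝓡 3) G) (GroupLieAlgebra (𝓡 3) G),
        IsAssociatedDerivation 𝒳 D ∧
        ∀ x₂ x₃ y₂ y₃ z₂ z₃ : ℝ,
          LinearMap.toMatrix E E D.toLinearMap = g31Block x₂ x₃ y₂ y₃ z₂ z₃ →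
          y₂ + z₃ = 0 → (y₂ - z₃) ^ 2 + 4 * y₃ * z₂ < 0 → HasPeriodicOrbit φ) := by
  -- Simple connectedness enters through connectedness, which the rigidity of automorphisms needs.
  have : ConnectedSpace G := inferInstance
  refine ⟨hE.exists_lieDerivation_iff, fun 𝒳 φ h =>
    ⟨h.derivation, h.isAssociatedDerivation, fun x₂ x₃ y₂ y₃ z₂ z₃ hM htr hdisc => ?_⟩⟩
  obtain ⟨hne, ν, hν, hD⟩ := exists_frequency_of_toMatrix_eq hM htr hdisc
  exact h.hasPeriodicOrbit hν hne hD
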